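/- Let $m\ge 0$ be an integer, let $\Sigma=\{0,1,\dots,m\}^{\mathbb N}$ be the full one-sided shift space with the product topology, the shift $\sigma$ (that is, $(\sigma \underline x)_i=x_{i+1}$) and the lexicographic order $<$. Let $b>1$ be a real number, and let $\dim_H$ denote Hausdorff dimension of subsets of $\Sigma$ with respect to the metric $\rho(\underline x,\underline y)=\sum_{i\ge 1}|x_i-y_i|\,b^{-i}$ (for instance $b=m+1$ if $m\ge1$), with $\dim_H\emptyset=0$. For $\underline c,\underline d\in\Sigma$ put $$M_{\underline c,\underline d}=\{\underline x\in\Sigma:\ \underline c\le\sigma^n(\underline x)<\underline x\le\underline d\ \text{ for all } n\ge 1\},$$ $$M_{\underline c}=\{\underline x\in\Sigma:\ \sigma^n(\underline x)<\underline x\le\underline c\ \text{ for all } n\ge 1\},\qquad N_{\underline c}=\{\underline x\in\Sigma:\ \underline c\le\sigma^n(\underline x)<\underline x\ \text{ for all } n\ge 1\}.$$ Then the map $(\underline c,\underline d)\mapsto\dim_H(M_{\underline c,\underline d})$ is continuous on $\Sigma\times\Sigma$. In particular, the maps $\underline c\mapsto\dim_H(M_{\underline c})$ and $\underline c\mapsto\dim_H(N_{\underline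 c})$ are continuous on $\Sigma$. -/

import Mathlib

namespace KneadingShift

/-- The full one-sided shift space on the alphabet `{0, 1, …, m}`, with the product topology.
The letter written `x₁` in mathematics is `x 0` here. -/
abbrev Shift (m : ℕ) : Type := ℕ → Fin (m + 1)

/-- The shift operator, `(σ x)ᵢ = xᵢ₊₁`. -/
def shift {m : ℕ} (x : Shift m) : Shift m := fun i => x (i + 1)

/-- The strict lexicographic order on sequences. -/
def LexLT {m : ℕ} (x y : Shift m) : Prop := toLex x < toLex y

/-- The lexicographic order on sequences. -/
def LexLE {m : ℕ} (x y : Shift m) : Prop := toLex x ≤ toLex y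

/-- The set `M_c = {x | σⁿ(x) < x ≤ c for all n > 0}`. -/
def setM {m : ℕ} (c : Shift m) : Set (Shift m) :=
  {x | ∀ n : ℕ, 0 < n → LexLT (shift^[n] x) x ∧ LexLE x c}

/-- The set `M_{c,d} = {x | c ≤ σⁿ(x) < x ≤ d for all n ≥ 1}`. -/
def setMM {m : ℕ} (c d : Shift m) : Set (Shift m) :=
  {x | ∀ n : ℕ, 1 ≤ n → LexLE c (shift^[n] x) ∧ LexLT (shift^[n] x) x ∧ LexLE x d}

/-- The set `N_c = {x | c ≤ σⁿ(x) < x for all n ≥ 1}`. -/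
def setN {m : ℕ} (c : Shift m) : Set (Shift m) :=
  {x | ∀ n : ℕ, 1 ≤ n → LexLE c (shift^[n] x) ∧ LexLT (shift^[n] x) x}

/-- The distance `∑_{i ≥ 1} |xᵢ - yᵢ| / bⁱ` on the shift space. -/
noncomputable def seqDist {m : ℕ} (b : ℝ) (x y : Shift m) : ℝ :=
  ∑' i : ℕ, |((x i : ℕ) : ℝ) - ((y i : ℕ) : ℝ)| / b ^ (i + 1)

theorem summable_seqDist {m : ℕ} {b : ℝ} (hb : 1 < b) (x y : Shift m) :
    Summable fun i : ℕ => |((x i : ℕ) : ℝ) - ((y i : ℕ) : ℝ)| / b ^ (i + 1) := by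
  have hb0 : 0 < b := by linarith
  have hg : Summable fun i : ℕ => (m : ℝ) * (b⁻¹) ^ (i + 1) :=
    (((summable_nat_add_iff 1).2
      (summable_geometric_of_lt_one (by positivity) (inv_lt_one_of_one_lt₀ hb)))).mul_left _
  refine Summable.of_nonneg_of_le (fun i => by positivity) (fun i => ?_) hg
  have hx : ((x i : ℕ) : ℝ) ≤ m := by exact_mod_cast Nat.lt_succ_iff.1 (x i).2
  have hy : ((y i : ℕ) : ℝ) ≤ m := by exact_mod_cast Nat.lt_succ_iff.1 (y i).2
  have hx0 : (0 : ℝ) ≤ ((x i : ℕ) : ℝ) := Nat.cast_nonneg _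
  have hy0 : (0 : ℝ) ≤ ((y i : ℕ) : ℝ) := Nat.cast_nonneg _
  rw [inv_pow, ← div_eq_mul_inv]
  gcongr
  rw [abs_le]
  constructor <;> linarith

/-- The metric `seqDist b` on the shift space, for a base `b > 1`. It is not an instance: the
topology used for continuity is the product topology, and this metric serves to define Hausdorff
dimension. -/
@[reducible] noncomputable def seqMetric (m : ℕ) (b : ℝ) (hb : 1 < b) :
    MetricSpace (Shift m) where
  dist := seqDist b
  dist_self x := by simp [seqDist]
  dist_comm x y := by simp [seqDist, abs_sub_comm]
  dist_triangle x y z := by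
    have hb0 : 0 < b := by linarith
    change seqDist b x z ≤ seqDist b x y + seqDist b y z
    unfold seqDist
    rw [← (summable_seqDist hb x y).tsum_add (summable_seqDist hb y z)]
    refine (summable_seqDist hb x z).tsum_le_tsum (fun i => ?_)
      ((summable_seqDist hb x y).add (summable_seqDist hb y z))
    rw [← add_div]
    gcongr
    exact abs_sub_le _ _ _
  eq_of_dist_eq_zero := by
    intro x y h
    have hb0 : 0 < b := by linarith
    change seqDist b x y = 0 at h
    unfold seqDist at h
    have h1 := (hasSum_zero_iff_of_nonneg (fun i => by positivity)).1
      (h ▸ (summable_seqDist hb x y).hasSum)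
    funext i
    have h2 := congrFun h1 i
    have h3 : b ^ (i + 1) ≠ 0 := by positivity
    simp only [Pi.zero_apply, div_eq_zero_iff, h3, or_false, abs_eq_zero, sub_eq_zero] at h2
    exact Fin.ext (by exact_mod_cast h2)

/-- The Hausdorff dimension of a subset of the shift space, for the metric `seqDist b`. -/
noncomputable def hdim {m : ℕ} (b : ℝ) (hb : 1 < b) (A : Set (Shift m)) : ENNReal :=
  @dimH (Shift m) (seqMetric m b hb).toEMetricSpace A

end KneadingShift

/-!
The dimension of `M_{c,d}` is governed by the numbers of *admissible* words of length `n`: those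
in which no factor shows that some shift is below `c` or above `d`. Since admissibility of words of
length `n` depends only on the first `n` letters of `c` and `d`, continuity follows from two bounds.

*Upper bound* (`hdim_setMM_le`). If for a single `n > 0` there are at most `b ^ (s * n)` admissible
words of length `n`, then covering `M_{c,d}` by cylinders over concatenations of such words shows
that its dimension is at most `s`.

*Lower bound* (`exists_forall_agree_le_hdim`). Suppose that for all `n` there are at least
`b ^ (s * n)` admissible words of length `n`, and let `s' < s`. Then `M_{c',d'}` has dimension at
least `s'` for all `c'`, `d'` close to `c`, `d`. The proof has three steps.

* After a word has been read, the constraints on its continuations are recorded by its longest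
  suffix `u` that is a prefix of `c` or `d`. Words that stay at long suffixes `u` are concatenations
  of long prefixes of `c` and `d`, and there are very few of these. Cutting admissible words at
  their visits to the finitely many short `u` therefore shows that the return words of some `u` grow
  at the rate of all admissible words (`exists_wt_returns_eq_top`). Growth is measured by
  generating functions at `b ^ (-s)`, which are submultiplicative under concatenation.
* Return words of `u` of a fixed length can be concatenated freely. Such concatenations contain no
  long prefix of `c` or `d`, so their orbits stay between `c'` and `d'` as soon as these agree with
  `c` and `d` on enough letters (`lexLE_concat_of_agree`).
* Discard the at most `n` blocks that are factors of the largest window `v` of length `2 * n`. A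
  concatenation of the remaining blocks, placed behind an initial piece containing `v`, gives a
  sequence whose shifts have a last maximum; this shift lies in `M_{c',d'}`
  (`concat_mem_iUnion_iterate`). Hence countably many Lipschitz images of `M_{c',d'}` cover a Cantor
  set of dimension at least `s'` (`le_dimH_range_of_separated`).

The sets `M_c` and `N_c` are the cases where `c` is the least, respectively `d` the greatest,
sequence.
-/

namespace KneadingShift

open Filter Topology
open scoped NNReal ENNReal

/-! ### Hausdorff dimension estimates in metric spaces -/

/-- A set that is covered, for every `q`, by at most `N ^ q` sets of diameter at most `C * δ ^ q`
has dimension at most `s` as soon as `N * δ ^ s ≤ 1`. -/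
theorem dimH_le_of_covers {X : Type*} [MetricSpace X] {A : Set X} {s : ℝ≥0} {C δ : ℝ}
    (hC : 0 ≤ C) (hδ0 : 0 ≤ δ) (hδ1 : δ < 1) {N : ℕ} (hN : (N : ℝ) * δ ^ (s : ℝ) ≤ 1)
    (ι : ℕ → Type*) [∀ q, Fintype (ι q)] (hι : ∀ q, Fintype.card (ι q) ≤ N ^ q)
    (t : ∀ q, ι q → Set X) (ht : ∀ q i, ∀ x ∈ t q i, ∀ y ∈ t q i, dist x y ≤ C * δ ^ q)
    (hA : ∀ q, A ⊆ ⋃ i, t q i) : dimH A ≤ s := by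
  borelize X
  apply dimH_le_of_hausdorffMeasure_ne_top
  have hdiam : ∀ q i, Metric.ediam (t q i) ≤ ENNReal.ofReal (C * δ ^ q) := fun q i =>
    Metric.ediam_le fun x hx y hy => by
      rw [edist_dist]
      exact ENNReal.ofReal_le_ofReal (ht q i x hx y hy)
  have hlim : Tendsto (fun q : ℕ => ENNReal.ofReal (C * δ ^ q)) atTop (𝓝 0) := by
    have h := (tendsto_pow_atTop_nhds_zero_of_lt_one hδ0 hδ1).const_mul C
    simpa using ENNReal.tendsto_ofReal h
  have hsum : ∀ q, ∑ i, Metric.ediam (t q i) ^ (s : ℝ) ≤ ENNReal.ofReal (C ^ (s : ℝ)) := by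
    intro q
    calc ∑ i, Metric.ediam (t q i) ^ (s : ℝ)
        ≤ ∑ _i : ι q, ENNReal.ofReal ((C * δ ^ q) ^ (s : ℝ)) := by
          refine Finset.sum_le_sum fun i _ => ?_
          rw [← ENNReal.ofReal_rpow_of_nonneg (by positivity) s.coe_nonneg]
          exact ENNReal.rpow_le_rpow (hdiam q i) s.coe_nonneg
      _ = ENNReal.ofReal (Fintype.card (ι q) * (C * δ ^ q) ^ (s : ℝ)) := by
          rw [Finset.sum_const, Finset.card_univ, nsmul_eq_mul,
            ENNReal.ofReal_mul (Nat.cast_nonneg _), ENNReal.ofReal_natCast]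
      _ ≤ ENNReal.ofReal (C ^ (s : ℝ)) := by
          apply ENNReal.ofReal_le_ofReal
          have h1 : (C * δ ^ q) ^ (s : ℝ) = C ^ (s : ℝ) * (δ ^ (s : ℝ)) ^ q := by
            rw [Real.mul_rpow hC (by positivity), ← Real.rpow_natCast, ← Real.rpow_natCast,
              ← Real.rpow_mul hδ0, ← Real.rpow_mul hδ0, mul_comm (q : ℝ)]
          have h2 : (Fintype.card (ι q) : ℝ) ≤ (N : ℝ) ^ q := by exact_mod_cast hι q
          have h3 : 0 ≤ C ^ (s : ℝ) := Real.rpow_nonneg hC _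
          have h4 : 0 ≤ δ ^ (s : ℝ) := Real.rpow_nonneg hδ0 _
          calc (Fintype.card (ι q) : ℝ) * (C * δ ^ q) ^ (s : ℝ)
              ≤ (N : ℝ) ^ q * (C ^ (s : ℝ) * (δ ^ (s : ℝ)) ^ q) := by rw [h1]; gcongr
            _ = C ^ (s : ℝ) * ((N : ℝ) * δ ^ (s : ℝ)) ^ q := by rw [mul_pow]; ring
            _ ≤ C ^ (s : ℝ) * 1 := by gcongr; exact pow_le_one₀ (by positivity) hN
            _ = C ^ (s : ℝ) := mul_one _
  have h := MeasureTheory.Measure.hausdorffMeasure_le_liminf_sum (s : ℝ) A _ hlim t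
    (Eventually.of_forall hdiam) (Eventually.of_forall hA)
  exact ne_top_of_le_ne_top ENNReal.ofReal_ne_top
    (h.trans ((liminf_le_liminf (Eventually.of_forall hsum)).trans_eq (liminf_const _)))

/-- A Cantor set coded by sequences over `r` digits, in which sequences that differ at the `j`-th
digit are `β ^ (j + 1)` apart, has dimension at least `α` as soon as `1 ≤ r * β ^ α`: reading the
digits in base `r` is an `α`-Hölder map onto the unit interval. -/
theorem le_dimH_range_of_separated {X : Type*} [MetricSpace X] {r : ℕ} (hr : 1 < r) {β : ℝ}
    (hβ : 0 < β) {α : ℝ≥0} (hα : 0 < α) (h : 1 ≤ (r : ℝ) * β ^ (α : ℝ)) (Φ : (ℕ → Fin r) → X)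
    (hΦ : ∀ ω ω' j, ω j ≠ ω' j → β ^ (j + 1) ≤ dist (Φ ω) (Φ ω')) :
    (α : ℝ≥0∞) ≤ dimH (Set.range Φ) := by
  have hr0 : (0 : ℝ) < r := by positivity
  have hinj : Function.Injective Φ := by
    intro ω ω' he
    by_contra hne
    obtain ⟨j, hj⟩ := Function.ne_iff.1 hne
    have h1 := hΦ ω ω' j hj
    rw [he, dist_self] at h1
    exact absurd h1 (not_le.2 (by positivity))
  have : Nonempty (ℕ → Fin r) := ⟨fun _ => ⟨0, by omega⟩⟩
  set f : X → ℝ := fun x => Real.ofDigits (Function.invFun Φ x) with hf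
  have hfΦ : ∀ ω, f (Φ ω) = Real.ofDigits ω := fun ω => by
    rw [hf]; simp only [Function.leftInverse_invFun hinj ω]
  have hhold : HolderOnWith (r : ℝ≥0) α f (Set.range Φ) := by
    rintro _ ⟨ω, rfl⟩ _ ⟨ω', rfl⟩
    rw [edist_dist, edist_dist, ENNReal.ofReal_rpow_of_nonneg dist_nonneg α.coe_nonneg,
      ← ENNReal.ofReal_coe_nnreal, ← ENNReal.ofReal_mul (by positivity), hfΦ, hfΦ, Real.dist_eq]
    apply ENNReal.ofReal_le_ofReal
    by_cases hne : ω = ω'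
    · subst hne
      simp only [sub_self, abs_zero]
      positivity
    have hex := Function.ne_iff.1 hne
    classical
    set j := Nat.find hex with hj
    have hjne : ω j ≠ ω' j := Nat.find_spec hex
    have hlt : ∀ i < j, ω i = ω' i := fun i hi => not_not.1 (Nat.find_min hex hi)
    have h1 := Real.abs_ofDigits_sub_ofDigits_le hlt
    have h2 : (β ^ (j + 1)) ^ (α : ℝ) ≤ dist (Φ ω) (Φ ω') ^ (α : ℝ) :=
      Real.rpow_le_rpow (by positivity) (hΦ ω ω' j hjne) α.coe_nonneg
    have h3 : (β ^ (j + 1)) ^ (α : ℝ) = (β ^ (α : ℝ)) ^ (j + 1) := by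
      rw [← Real.rpow_natCast, ← Real.rpow_natCast, ← Real.rpow_mul hβ.le, ← Real.rpow_mul hβ.le,
        mul_comm]
    have h4 : (r : ℝ)⁻¹ ≤ β ^ (α : ℝ) := by
      rw [inv_le_iff_one_le_mul₀' hr0]; exact h
    calc |Real.ofDigits ω - Real.ofDigits ω'| ≤ ((r : ℝ) ^ j)⁻¹ := h1
      _ = r * ((r : ℝ)⁻¹) ^ (j + 1) := by rw [pow_succ, inv_pow]; field_simp
      _ ≤ r * (β ^ (α : ℝ)) ^ (j + 1) := by gcongr
      _ ≤ r * dist (Φ ω) (Φ ω') ^ (α : ℝ) := by rw [← h3]; gcongr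
      _ = ((r : ℝ≥0) : ℝ) * dist (Φ ω) (Φ ω') ^ (α : ℝ) := by simp
  have himg : Set.Ico (0 : ℝ) 1 ⊆ f '' Set.range Φ := by
    intro x hx
    have : NeZero r := ⟨by omega⟩
    exact ⟨Φ (Real.digits x r), ⟨_, rfl⟩, by rw [hfΦ]; exact Real.ofDigits_digits hr hx⟩
  have hone : (1 : ℝ≥0∞) ≤ dimH (f '' Set.range Φ) := by
    have h1 : dimH (Set.Ico (0 : ℝ) 1) = 1 := by
      rw [Real.dimH_of_nonempty_interior]
      · simp
      · rw [interior_Ico]; exact ⟨1 / 2, by norm_num, by norm_num⟩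
    rw [← h1]
    exact dimH_mono himg
  have h5 := hone.trans (hhold.dimH_image_le hα)
  rw [ENNReal.le_div_iff_mul_le (Or.inl (by exact_mod_cast hα.ne')) (Or.inl ENNReal.coe_ne_top),
    one_mul] at h5
  exact h5

/-- A set covered by the images of `M` under the iterates of a Lipschitz map has dimension at most
that of `M`. -/
theorem dimH_le_of_subset_iUnion_iterate {X : Type*} [MetricSpace X] {f : X → X} {K : ℝ}
    (hf : ∀ x y, dist (f x) (f y) ≤ K * dist x y) {A M : Set X}
    (h : A ⊆ ⋃ n : ℕ, f^[n] '' M) : dimH A ≤ dimH M := by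
  refine (dimH_mono h).trans ?_
  rw [dimH_iUnion]
  exact iSup_le fun n => ((LipschitzWith.of_dist_le' hf).iterate n).dimH_image_le M

/-! ### The metric on the shift space -/

variable {m : ℕ} {b : ℝ}

theorem le_seqDist_of_ne (hb : 1 < b) {x y : Shift m} {i : ℕ} (h : x i ≠ y i) :
    (b⁻¹) ^ (i + 1) ≤ seqDist b x y := by
  have hb0 : 0 < b := by linarith
  have h1 : |((x i : ℕ) : ℝ) - ((y i : ℕ) : ℝ)| / b ^ (i + 1) ≤ seqDist b x y :=
    (summable_seqDist hb x y).le_tsum i fun j _ => by positivity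
  refine le_trans ?_ h1
  have h2 : (1 : ℝ) ≤ |((x i : ℕ) : ℝ) - ((y i : ℕ) : ℝ)| := by
    have h3 : ((x i : ℕ) : ℤ) - ((y i : ℕ) : ℤ) ≠ 0 := by
      intro h0
      exact h (Fin.ext (by omega))
    exact_mod_cast Int.one_le_abs h3
  rw [inv_pow, ← one_div]
  gcongr

theorem seqDist_le_of_agree (hb : 1 < b) {x y : Shift m} {n : ℕ} (h : ∀ i < n, x i = y i) :
    seqDist b x y ≤ m / (b - 1) * (b⁻¹) ^ n := by
  have hb0 : 0 < b := by linarith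
  have hb1 : 0 < b - 1 := by linarith
  unfold seqDist
  rw [← (summable_seqDist hb x y).sum_add_tsum_nat_add n]
  rw [Finset.sum_eq_zero fun i hi => by simp [h i (Finset.mem_range.1 hi)], zero_add]
  have hg := (hasSum_geometric_of_lt_one (r := b⁻¹) (by positivity)
    (inv_lt_one_of_one_lt₀ hb)).mul_left ((m : ℝ) * (b⁻¹) ^ (n + 1))
  calc ∑' i, |((x (i + n) : ℕ) : ℝ) - ((y (i + n) : ℕ) : ℝ)| / b ^ (i + n + 1)
      ≤ ∑' i : ℕ, (m : ℝ) * (b⁻¹) ^ (n + 1) * (b⁻¹) ^ i := by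
        refine ((summable_nat_add_iff n).2 (summable_seqDist hb x y)).tsum_le_tsum (fun i => ?_)
          hg.summable
        have hx : ((x (i + n) : ℕ) : ℝ) ≤ m := by exact_mod_cast Nat.lt_succ_iff.1 (x (i + n)).2
        have hy : ((y (i + n) : ℕ) : ℝ) ≤ m := by exact_mod_cast Nat.lt_succ_iff.1 (y (i + n)).2
        have hx0 : (0 : ℝ) ≤ ((x (i + n) : ℕ) : ℝ) := Nat.cast_nonneg _
        have hy0 : (0 : ℝ) ≤ ((y (i + n) : ℕ) : ℝ) := Nat.cast_nonneg _
        rw [mul_assoc, ← pow_add, inv_pow, ← div_eq_mul_inv, show n + 1 + i = i + n + 1 by ring]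
        gcongr
        rw [abs_le]
        constructor <;> linarith
    _ = m / (b - 1) * (b⁻¹) ^ n := by
        rw [hg.tsum_eq, pow_succ]
        field_simp

theorem seqDist_shift_le (hb : 1 < b) (x y : Shift m) :
    seqDist b (shift x) (shift y) ≤ b * seqDist b x y := by
  have hb0 : 0 < b := by linarith
  unfold seqDist
  rw [← (summable_seqDist hb x y).sum_add_tsum_nat_add 1, mul_add, ← tsum_mul_left]
  refine le_add_of_nonneg_of_le (mul_nonneg hb0.le (Finset.sum_nonneg fun i _ => by positivity))
    (le_of_eq (tsum_congr fun i => ?_))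
  simp only [shift]
  rw [pow_succ b (i + 1)]
  field_simp

theorem iterate_shift_apply (n : ℕ) (x : Shift m) (i : ℕ) : shift^[n] x i = x (n + i) := by
  induction n generalizing x with
  | zero => simp
  | succ n ih =>
    rw [Function.iterate_succ_apply, ih]
    simp only [shift]
    congr 1
    omega

/-! ### Weights of languages -/

section Weight

variable {α : Type*} {θ : ℝ≥0∞}

/-- The weight `∑_{w ∈ W} θ ^ |w|` of a language `W`, that is, the value at `θ` of its generating
function. -/
noncomputable def wt (θ : ℝ≥0∞) (W : Language α) : ℝ≥0∞ :=
  ∑' w : {w : List α // w ∈ W}, θ ^ w.1.length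

/-- The number of words of length `n` in a language. -/
noncomputable def count (W : Language α) (n : ℕ) : ℕ :=
  Nat.card {f : Fin n → α // List.ofFn f ∈ W}

theorem wt_mono {U V : Language α} (h : ∀ w ∈ U, w ∈ V) : wt θ U ≤ wt θ V :=
  ENNReal.tsum_mono_subtype (fun w : List α => θ ^ w.length) h

theorem wt_add_le (U V : Language α) : wt θ (U + V) ≤ wt θ U + wt θ V :=
  ENNReal.tsum_union_le (fun w : List α => θ ^ w.length) U V

theorem wt_mul_le (U V : Language α) : wt θ (U * V) ≤ wt θ U * wt θ V := by
  have hsurj : Function.Surjective (fun q : {w // w ∈ U} × {w // w ∈ V} =>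
      (⟨q.1.1 ++ q.2.1, Language.append_mem_mul q.1.2 q.2.2⟩ : {w // w ∈ U * V})) := by
    rintro ⟨w, hw⟩
    obtain ⟨x, hx, y, hy, rfl⟩ := Language.mem_mul.1 hw
    exact ⟨(⟨x, hx⟩, ⟨y, hy⟩), rfl⟩
  refine (ENNReal.tsum_le_tsum_comp_of_surjective hsurj _).trans_eq ?_
  simp only [List.length_append, pow_add]
  rw [ENNReal.tsum_prod (f := fun (x : {w // w ∈ U}) (y : {w // w ∈ V}) =>
    θ ^ x.1.length * θ ^ y.1.length)]
  simp only [ENNReal.tsum_mul_left, ENNReal.tsum_mul_right, wt]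

theorem wt_pow_le (U : Language α) (k : ℕ) : wt θ (U ^ k) ≤ wt θ U ^ k := by
  induction k with
  | zero =>
    rw [pow_zero, pow_zero]
    have h1 : wt θ (1 : Language α) = ∑' w : ({[]} : Set (List α)), θ ^ w.1.length := rfl
    rw [h1, tsum_singleton ([] : List α) fun w => θ ^ w.length]
    simp
  | succ k ih =>
    rw [pow_succ, pow_succ]
    exact (wt_mul_le _ _).trans (by gcongr)

theorem wt_kstar_ne_top {U : Language α} (h : wt θ U < 1) : wt θ (KStar.kstar U) ≠ ⊤ := by
  have h1 : wt θ (KStar.kstar U) ≤ ∑' k : ℕ, wt θ (U ^ k) := by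
    rw [Language.kstar_eq_iSup_pow]
    exact ENNReal.tsum_iUnion_le_tsum (fun w : List α => θ ^ w.length) fun k : ℕ => U ^ k
  refine ne_top_of_le_ne_top ?_ (h1.trans (ENNReal.tsum_le_tsum fun k => wt_pow_le U k))
  rw [ENNReal.tsum_geometric]
  exact ENNReal.inv_ne_top.2 (tsub_pos_of_lt h).ne'

theorem wt_range_le {ι : Type*} (g : ι → List α) :
    wt θ (Set.range g : Set (List α)) ≤ ∑' i, θ ^ (g i).length :=
  ENNReal.tsum_le_tsum_comp_of_surjective (Set.rangeFactorization_surjective (f := g))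
    fun w : {w : List α // w ∈ Set.range g} => θ ^ w.1.length

theorem wt_eq_tsum_count [Finite α] (W : Language α) :
    wt θ W = ∑' n, (count W n : ℝ≥0∞) * θ ^ n := by
  classical
  have := Fintype.ofFinite α
  have hbij : Function.Bijective (fun q : Σ n, {f : Fin n → α // List.ofFn f ∈ W} =>
      (⟨List.ofFn q.2.1, q.2.2⟩ : {w // w ∈ W})) := by
    constructor
    · rintro ⟨n, f, hf⟩ ⟨n', f', hf'⟩ h
      have h1 : List.ofFn f = List.ofFn f' := congrArg Subtype.val h
      have h2 : n = n' := by simpa using congrArg List.length h1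
      subst h2
      have h3 := List.ofFn_injective h1
      subst h3
      rfl
    · rintro ⟨w, hw⟩
      exact ⟨⟨w.length, w.get, by rwa [List.ofFn_get]⟩, Subtype.ext (List.ofFn_get w)⟩
  rw [wt, ← (Equiv.ofBijective _ hbij).tsum_eq, ENNReal.tsum_sigma']
  refine tsum_congr fun n => ?_
  simp [count, tsum_fintype]

end Weight

/-! ### Longest suffixes in a prefix-closed language, and return words -/

section Returns

variable {α : Type*} {P Adm : Language α}

/-- `u` is the longest suffix of `p` that belongs to the language `P`. If `P` consists of the
prefixes of some sequences, `u` records all partial matches of these sequences that are pending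
after `p` has been read. -/
def IsLongestSuffix (P : Language α) (p u : List α) : Prop :=
  u ∈ P ∧ u <:+ p ∧ ∀ v ∈ P, v <:+ p → v <:+ u

/-- The return words of `u`: the words `w` such that `u ++ w` is admissible and has again `u` as
its longest suffix in `P`. -/
def returns (P Adm : Language α) (u : List α) : Language α :=
  {w | u ++ w ∈ Adm ∧ IsLongestSuffix P (u ++ w) u}

theorem exists_isLongestSuffix (hnil : [] ∈ P) (p : List α) : ∃ u, IsLongestSuffix P p u := by
  induction p with
  | nil => exact ⟨[], hnil, List.suffix_rfl, fun v _ h => h⟩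
  | cons a q ih =>
    by_cases hp : a :: q ∈ P
    · exact ⟨_, hp, List.suffix_rfl, fun v _ h => h⟩
    · obtain ⟨u, hu, huq, hmax⟩ := ih
      refine ⟨u, hu, huq.trans (List.suffix_cons a q), fun v hv hvp => ?_⟩
      rcases List.suffix_cons_iff.1 hvp with rfl | h
      · exact absurd hv hp
      · exact hmax v hv h

theorem IsLongestSuffix.suffix_append_iff (hP : ∀ u v, u <+: v → v ∈ P → u ∈ P) {p u : List α}
    (h : IsLongestSuffix P p u) (v : List α) {y : List α} (hy : y ∈ P) :
    y <:+ p ++ v ↔ y <:+ u ++ v := by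
  constructor
  · intro hyp
    rcases List.suffix_or_suffix_of_suffix hyp (List.suffix_append p v) with h1 | ⟨s, rfl⟩
    · exact h1.trans (List.suffix_append u v)
    · obtain ⟨t, ht⟩ := hyp
      rw [← List.append_assoc] at ht
      have hs : s <:+ p := ⟨t, List.append_cancel_right ht⟩
      obtain ⟨t', ht'⟩ := h.2.2 s (hP _ _ (List.prefix_append s v) hy) hs
      exact ⟨t', by rw [← List.append_assoc, ht']⟩
  · intro hyu
    obtain ⟨t, ht⟩ := h.2.1
    exact hyu.trans ⟨t, by rw [← List.append_assoc, ht]⟩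

theorem IsLongestSuffix.append_iff (hP : ∀ u v, u <+: v → v ∈ P → u ∈ P) {p u : List α}
    (h : IsLongestSuffix P p u) (v x : List α) :
    IsLongestSuffix P (p ++ v) x ↔ IsLongestSuffix P (u ++ v) x := by
  constructor
  · rintro ⟨h1, h2, h3⟩
    exact ⟨h1, (h.suffix_append_iff hP v h1).1 h2,
      fun y hy hyu => h3 y hy ((h.suffix_append_iff hP v hy).2 hyu)⟩
  · rintro ⟨h1, h2, h3⟩
    exact ⟨h1, (h.suffix_append_iff hP v h1).2 h2,
      fun y hy hyu => h3 y hy ((h.suffix_append_iff hP v hy).1 hyu)⟩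

/-- Admissible continuations `w` of `p` such that, after every nonempty prefix of `w` has been read,
the longest suffix in `P` is outside `F` or inside `S`. -/
def continuations (P Adm : Language α) (F S : Set (List α)) (p : List α) : Language α :=
  {w | p ++ w ∈ Adm ∧
    ∀ w', w' ≠ [] → w' <+: w → ∀ u, IsLongestSuffix P (p ++ w') u → u ∈ F → u ∈ S}

/-- The words consisting of a single letter. -/
def letters (α : Type*) : Language α :=
  Set.range fun a : α => [a]

variable {θ : ℝ≥0∞}

theorem wt_append_mem_ne_top (hθ : θ ≠ 0) {W : Language α} (hW : wt θ W ≠ ⊤) (s : List α) :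
    wt θ ({w | s ++ w ∈ W} : Set (List α)) ≠ ⊤ := by
  intro h
  have h1 : θ ^ s.length * wt θ ({w | s ++ w ∈ W} : Set (List α)) ≤ wt θ W := by
    have hinj : Function.Injective (fun w : {w : List α // w ∈ {w | s ++ w ∈ W}} =>
        (⟨s ++ w.1, w.2⟩ : {w // w ∈ W})) := by
      intro x y hxy
      exact Subtype.ext (List.append_cancel_left (congrArg Subtype.val hxy))
    refine le_trans (le_of_eq ?_) (ENNReal.tsum_comp_le_tsum_of_injective hinj _)
    simp only [List.length_append, pow_add, ENNReal.tsum_mul_left]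
    rfl
  rw [h, ENNReal.mul_top (pow_ne_zero _ hθ), top_le_iff] at h1
  exact hW h1

/-- A continuation of `p` all of whose longest suffixes in `P` are outside `F` factors, read from
its end, into words of `P` outside `F` and one initial piece of a word of `P`. -/
theorem wt_continuations_empty_ne_top (hnil : [] ∈ P) (hAdm : ∀ u v, u <:+: v → v ∈ Adm → u ∈ Adm)
    (hθ : θ ≠ 0) (hwP : wt θ P ≠ ⊤) {F : Set (List α)} (hF : [] ∈ F)
    (hwF : wt θ ({w | w ∈ P ∧ w ∉ F} : Set (List α)) < 1) (p : List α) :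
    wt θ (continuations P Adm F ∅ p) ≠ ⊤ := by
  classical
  set G : Language α := ({w | w ∈ P ∧ w ∉ F} : Set (List α)) with hG
  set D : Language α := (⋃ s ∈ p.tails.toFinset, {w | s ++ w ∈ P} : Set (List α)) with hD
  have hmemD : ∀ w : List α, w ∈ D ↔ ∃ s, s <:+ p ∧ s ++ w ∈ P := by
    intro w
    change w ∈ (⋃ s ∈ p.tails.toFinset, {w | s ++ w ∈ P} : Set (List α)) ↔ _
    simp [List.mem_tails]
  have hsub : ∀ n, ∀ w : List α, w.length = n → w ∈ continuations P Adm F ∅ p →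
      w ∈ D * KStar.kstar G := by
    intro n
    induction n using Nat.strong_induction_on with
    | _ n ih =>
      rintro w hwn ⟨hw1, hw2⟩
      by_cases hw0 : w = []
      · subst hw0
        exact Language.mem_mul.2 ⟨[], (hmemD []).2 ⟨[], List.nil_suffix, hnil⟩, [],
          Language.nil_mem_kstar _, rfl⟩
      obtain ⟨u, hu⟩ := exists_isLongestSuffix hnil (p ++ w)
      have huF : u ∉ F := fun h => hw2 w hw0 List.prefix_rfl u hu h
      rcases List.suffix_or_suffix_of_suffix hu.2.1 (List.suffix_append p w) with ⟨v, hv⟩ | ⟨s, hs⟩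
      · have hv2 : v ∈ continuations P Adm F ∅ p := by
          refine ⟨hAdm _ _ ?_ hw1, fun w' h1 h2 => hw2 w' h1 (h2.trans ⟨u, hv⟩)⟩
          rw [← hv, ← List.append_assoc]
          exact (List.prefix_append _ _).isInfix
        have hu0 : u ≠ [] := fun h => huF (h ▸ hF)
        have hlen : v.length < n := by
          rw [← hwn, ← hv, List.length_append]
          have := List.length_pos_of_ne_nil hu0
          omega
        obtain ⟨x, hx, y, hy, rfl⟩ := Language.mem_mul.1 (ih _ hlen v rfl hv2)
        refine Language.mem_mul.2 ⟨x, hx, y ++ u, ?_, by rw [← hv, List.append_assoc]⟩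
        rw [Language.mem_kstar] at hy ⊢
        obtain ⟨L, rfl, hL⟩ := hy
        refine ⟨L ++ [u], by simp, fun z hz => ?_⟩
        rcases List.mem_append.1 hz with h | h
        · exact hL z h
        · rw [List.mem_singleton.1 h]
          exact ⟨hu.1, huF⟩
      · refine Language.mem_mul.2
          ⟨w, (hmemD w).2 ⟨s, ?_, ?_⟩, [], Language.nil_mem_kstar _, by simp⟩
        · obtain ⟨t, ht⟩ := hu.2.1
          rw [← hs, ← List.append_assoc] at ht
          exact ⟨t, List.append_cancel_right ht⟩
        · rw [hs]
          exact hu.1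
  refine ne_top_of_le_ne_top ?_ ((wt_mono fun w hw => hsub _ w rfl hw).trans (wt_mul_le _ _))
  refine ENNReal.mul_ne_top ?_ (wt_kstar_ne_top hwF)
  refine ne_top_of_le_ne_top ?_
    (ENNReal.tsum_biUnion_le (fun w : List α => θ ^ w.length) p.tails.toFinset _)
  exact (ENNReal.sum_lt_top.2 fun s _ => (wt_append_mem_ne_top hθ hwP s).lt_top).ne

/-- A continuation that passes through `u` is cut at its first and at its last visit to `u`. -/
theorem continuations_insert_subset (hP : ∀ u v, u <+: v → v ∈ P → u ∈ P)
    (hAdm : ∀ u v, u <:+: v → v ∈ Adm → u ∈ Adm) {F S : Set (List α)} {u p w : List α}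
    (hw : w ∈ continuations P Adm F (insert u S) p) :
    w ∈ continuations P Adm F S p +
      continuations P Adm F S p * letters α *
        returns P Adm u * continuations P Adm F S u := by
  classical
  obtain ⟨hw1, hw2⟩ := hw
  by_cases hex : ∃ k, 0 < k ∧ k ≤ w.length ∧ IsLongestSuffix P (p ++ w.take k) u
  swap
  · left
    refine ⟨hw1, fun w' h1 h2 v hv hvF => ?_⟩
    refine (hw2 w' h1 h2 v hv hvF).resolve_left ?_
    rintro rfl
    refine hex ⟨w'.length, List.length_pos_of_ne_nil h1, h2.length_le, ?_⟩
    rwa [← List.prefix_iff_eq_take.1 h2]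
  · right
    set k := Nat.find hex with hk
    obtain ⟨hk0, hkw, hku⟩ : 0 < k ∧ k ≤ w.length ∧ IsLongestSuffix P (p ++ w.take k) u :=
      Nat.find_spec hex
    set K := Nat.findGreatest (fun j => IsLongestSuffix P (p ++ w.take j) u) w.length with hK
    have hkK : k ≤ K := Nat.le_findGreatest hkw hku
    have hKw : K ≤ w.length := Nat.findGreatest_le _
    have hKu : IsLongestSuffix P (p ++ w.take K) u :=
      Nat.findGreatest_spec (P := fun j => IsLongestSuffix P (p ++ w.take j) u) hkw hku
    have hsplit : w.take K = w.take k ++ (w.take K).drop k := by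
      conv_lhs => rw [← List.take_append_drop k (w.take K)]
      rw [List.take_take, min_eq_left hkK]
    obtain ⟨t, ht⟩ := hku.2.1
    obtain ⟨t', ht'⟩ := hKu.2.1
    obtain ⟨w1, a, hw1a⟩ : ∃ w1 a, w.take k = w1 ++ [a] := by
      have hne : w.take k ≠ [] := by
        intro h0
        have := congrArg List.length h0
        simp at this
        rcases this with h | h
        · omega
        · subst h; simp at hkw; omega
      exact ⟨_, _, (List.dropLast_append_getLast hne).symm⟩
    have hlen1 : w1.length + 1 = k := by
      have := congrArg List.length hw1a
      simp at this
      omega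
    refine Language.mem_mul.2 ⟨w.take K, ?_, w.drop K, ?_, List.take_append_drop K w⟩
    · refine Language.mem_mul.2 ⟨w.take k, ?_, (w.take K).drop k, ?_, hsplit.symm⟩
      · refine Language.mem_mul.2 ⟨w1, ?_, [a], ⟨a, rfl⟩, hw1a.symm⟩
        have hpre : w1 <+: w := (List.prefix_append w1 [a]).trans (hw1a ▸ List.take_prefix k w)
        refine ⟨hAdm _ _ ?_ hw1, fun w' h1 h2 v hv hvF => ?_⟩
        · exact ((List.prefix_append_right_inj p).2 hpre).isInfix
        · refine (hw2 w' h1 (h2.trans hpre) v hv hvF).resolve_left ?_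
          rintro rfl
          have hlt : w'.length < k := by have := h2.length_le; omega
          refine Nat.find_min hex hlt ⟨List.length_pos_of_ne_nil h1, by omega, ?_⟩
          rwa [← List.prefix_iff_eq_take.1 (h2.trans hpre)]
      · constructor
        · refine hAdm _ _ ⟨t, w.drop K, ?_⟩ hw1
          rw [← List.append_assoc, ht, List.append_assoc p, ← hsplit, List.append_assoc,
            List.take_append_drop]
        · rw [← hku.append_iff hP, List.append_assoc, ← hsplit]
          exact hKu
    · refine ⟨hAdm _ _ ⟨t', [], ?_⟩ hw1, fun w' h1 h2 v hv hvF => ?_⟩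
      · rw [List.append_nil, ← List.append_assoc, ht', List.append_assoc, List.take_append_drop]
      · rw [← hKu.append_iff hP, List.append_assoc] at hv
        have hpre : w.take K ++ w' <+: w := by
          conv_rhs => rw [← List.take_append_drop K w]
          exact (List.prefix_append_right_inj _).2 h2
        refine (hw2 _ (by simp [h1]) hpre v hv hvF).resolve_left ?_
        rintro rfl
        have hlen : (w.take K ++ w').length = K + w'.length := by simp [hKw]
        have hpos := List.length_pos_of_ne_nil h1
        rw [List.prefix_iff_eq_take.1 hpre, hlen] at hv
        have hle := hpre.length_le
        rw [hlen] at hle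
        have := Nat.le_findGreatest (P := fun j => IsLongestSuffix P (p ++ w.take j) v) hle hv
        omega

/-- If the admissible words have infinite weight while the words of `P` have finite weight, then
the return words of some `u` have infinite weight. All but finitely many words of `P` have total
weight less than `1`, so excursions avoiding these finitely many words have finite weight; an
admissible word is cut at its visits to the finitely many exceptional words. -/
theorem exists_wt_returns_eq_top [Finite α] (hnil : [] ∈ P) (hP : ∀ u v, u <+: v → v ∈ P → u ∈ P)
    (hAdm : ∀ u v, u <:+: v → v ∈ Adm → u ∈ Adm) (hθ : θ ≠ 0) (hθ' : θ ≠ ⊤) (hwP : wt θ P ≠ ⊤)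
    (hw : wt θ Adm = ⊤) : ∃ u ∈ P, wt θ (returns P Adm u) = ⊤ := by
  classical
  by_contra! hcon
  have hret : ∀ u, wt θ (returns P Adm u) ≠ ⊤ := by
    intro u
    by_cases hu : u ∈ P
    · exact hcon u hu
    · have h0 : returns P Adm u = 0 := Set.eq_empty_of_forall_notMem fun w hw => hu hw.2.1
      rw [h0]
      exact ne_top_of_le_ne_top hwP (wt_mono fun w hw => absurd hw (Language.notMem_zero w))
  have hlet : wt θ (letters α) ≠ ⊤ := by
    have := Fintype.ofFinite α
    refine ne_top_of_le_ne_top ?_ (wt_range_le _)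
    rw [tsum_fintype]
    exact (ENNReal.sum_lt_top.2 fun a _ => (ENNReal.pow_ne_top hθ').lt_top).ne
  obtain ⟨F, hF0, hF⟩ : ∃ F : Finset (List α), [] ∈ F ∧
      wt θ ({w | w ∈ P ∧ w ∉ F} : Set (List α)) < 1 := by
    have h1 := ENNReal.tendsto_tsum_compl_atTop_zero hwP
    obtain ⟨s, hs⟩ := ((tendsto_order.1 h1).2 1 one_pos).exists
    refine ⟨insert [] (s.image Subtype.val), Finset.mem_insert_self _ _, lt_of_le_of_lt ?_ hs⟩
    have hinj : Function.Injective
        (fun w : {w : List α // w ∈ {w | w ∈ P ∧ w ∉ insert [] (s.image Subtype.val)}} =>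
          (⟨⟨w.1, w.2.1⟩, fun h => w.2.2 (Finset.mem_insert_of_mem
            (Finset.mem_image_of_mem Subtype.val h))⟩ : {x : {w // w ∈ P} // x ∉ s})) := by
      intro x y hxy
      exact Subtype.ext (congrArg (fun z => z.1.1) hxy)
    exact ENNReal.tsum_comp_le_tsum_of_injective hinj
      fun x : {x : {w // w ∈ P} // x ∉ s} => θ ^ x.1.1.length
  have key : ∀ S : Finset (List α), ∀ p, wt θ (continuations P Adm F S p) ≠ ⊤ := by
    intro S
    induction S using Finset.induction_on with
    | empty =>
      intro p
      rw [Finset.coe_empty]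
      exact wt_continuations_empty_ne_top hnil hAdm hθ hwP hF0 hF p
    | insert u S _ ih =>
      intro p
      rw [Finset.coe_insert]
      refine ne_top_of_le_ne_top ?_
        ((wt_mono fun w hw => continuations_insert_subset hP hAdm hw).trans (wt_add_le _ _))
      refine ENNReal.add_ne_top.2 ⟨ih p, ne_top_of_le_ne_top ?_ (wt_mul_le _ _)⟩
      refine ENNReal.mul_ne_top (ne_top_of_le_ne_top ?_ (wt_mul_le _ _)) (ih u)
      refine ENNReal.mul_ne_top (ne_top_of_le_ne_top ?_ (wt_mul_le _ _)) (hret u)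
      exact ENNReal.mul_ne_top (ih p) hlet
  refine key F [] (top_le_iff.1 (hw ▸ wt_mono fun w hw => ⟨hw, fun _ _ _ _ _ h => h⟩))

end Returns

/-! ### Lexicographic order and finite windows -/

theorem lexLT_iff {x y : Shift m} :
    LexLT x y ↔ ∃ l, (∀ i < l, x i = y i) ∧ x l < y l := Iff.rfl

theorem lexLE_iff_not_lexLT {x y : Shift m} : LexLE x y ↔ ¬ LexLT y x := not_lt.symm

theorem LexLT.lexLE {x y : Shift m} (h : LexLT x y) : LexLE x y := le_of_lt (α := Lex (Shift m)) h

/-- The word `x t, x (t + 1), …, x (t + n - 1)`. -/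
def word (x : Shift m) (t n : ℕ) : List (Fin (m + 1)) := List.ofFn fun i : Fin n => x (t + i)

@[simp] theorem length_word (x : Shift m) (t n : ℕ) : (word x t n).length = n := by simp [word]

theorem word_add (x : Shift m) (t n k : ℕ) : word x t (n + k) = word x t n ++ word x (t + n) k := by
  refine List.ext_getElem (by simp) fun i h1 h2 => ?_
  simp only [length_word] at h1
  by_cases hi : i < n
  · rw [List.getElem_append_left (by simpa using hi)]
    simp [word]
  · rw [List.getElem_append_right (by simpa using hi)]
    simp only [word, List.getElem_ofFn, List.length_ofFn]
    congr 1
    omega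

theorem word_eq_word_iff {x y : Shift m} {s t n : ℕ} :
    word x s n = word y t n ↔ ∀ i < n, x (s + i) = y (t + i) := by
  rw [word, word, List.ofFn_inj, funext_iff]
  exact ⟨fun h i hi => h ⟨i, hi⟩, fun h i => h i i.2⟩

theorem word_succ (x : Shift m) (t n : ℕ) : word x t (n + 1) = word x t n ++ [x (t + n)] := by
  rw [word_add]
  simp [word]

theorem isInfix_word_iff {x : Shift m} {t n : ℕ} {u : List (Fin (m + 1))} :
    u <:+: word x t n ↔ ∃ i, i + u.length ≤ n ∧ u = word x (t + i) u.length := by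
  constructor
  · rintro ⟨p, q, h⟩
    have hlen := congrArg List.length h
    simp only [List.length_append, length_word] at hlen
    refine ⟨p.length, by omega, ?_⟩
    rw [← hlen, word_add, word_add, List.append_assoc, List.append_assoc] at h
    have h1 := List.append_inj h (by simp)
    exact (List.append_inj h1.2 (by simp)).1
  · rintro ⟨i, hi, h⟩
    obtain ⟨j, rfl⟩ := Nat.exists_eq_add_of_le hi
    rw [word_add, word_add, ← h]
    exact ⟨_, _, rfl⟩

/-! ### Admissible words -/

/-- The prefixes of `c` and of `d`. -/
def prefixes (c d : Shift m) : Language (Fin (m + 1)) :=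
  (Set.range (word c 0) ∪ Set.range (word d 0) : Set (List (Fin (m + 1))))

/-- The words in which no factor witnesses that some shift lies below `c` or above `d`. -/
def admissible (c d : Shift m) : Language (Fin (m + 1)) :=
  {w | ∀ l a, (a < c l → ¬ word c 0 l ++ [a] <:+: w) ∧ (d l < a → ¬ word d 0 l ++ [a] <:+: w)}

theorem nil_mem_prefixes (c d : Shift m) : [] ∈ prefixes c d := Or.inl ⟨0, rfl⟩

theorem prefixes_prefix_closed (c d : Shift m) (u v : List (Fin (m + 1))) (h : u <+: v)
    (hv : v ∈ prefixes c d) : u ∈ prefixes c d := by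
  have key : ∀ e : Shift m, v ∈ Set.range (word e 0) → u ∈ Set.range (word e 0) := by
    rintro e ⟨n, rfl⟩
    obtain ⟨i, rfl⟩ : ∃ i, n = u.length + i :=
      Nat.exists_eq_add_of_le (by simpa using h.length_le)
    obtain ⟨w, hw⟩ := h
    rw [word_add] at hw
    exact ⟨u.length, (List.append_inj hw (by simp)).1.symm⟩
  exact hv.imp (key c) (key d)

theorem admissible_infix_closed (c d : Shift m) (u v : List (Fin (m + 1))) (h : u <:+: v)
    (hv : v ∈ admissible c d) : u ∈ admissible c d := fun l a =>
  ⟨fun ha hu => (hv l a).1 ha (hu.trans h), fun ha hu => (hv l a).2 ha (hu.trans h)⟩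

theorem word_mem_admissible {c d x : Shift m}
    (hx : ∀ t, LexLE c (shift^[t] x) ∧ LexLE (shift^[t] x) d) (t n : ℕ) :
    word x t n ∈ admissible c d := by
  have key : ∀ (e : Shift m) (l : ℕ) (a : Fin (m + 1)), word e 0 l ++ [a] <:+: word x t n →
      ∃ k, (∀ i < l, shift^[k] x i = e i) ∧ shift^[k] x l = a := by
    intro e l a h
    obtain ⟨i, -, hi⟩ := isInfix_word_iff.1 h
    simp only [List.length_append, length_word, List.length_singleton] at hi
    rw [word_succ] at hi
    obtain ⟨h1, h2⟩ := List.append_inj hi (by simp)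
    refine ⟨t + i, fun j hj => ?_, ?_⟩
    · rw [iterate_shift_apply, ← word_eq_word_iff.1 h1 j hj, zero_add]
    · rw [iterate_shift_apply]
      exact (List.singleton_inj.1 h2).symm
  refine fun l a => ⟨fun ha h => ?_, fun ha h => ?_⟩
  · obtain ⟨k, h1, rfl⟩ := key c l a h
    exact lexLE_iff_not_lexLT.1 (hx k).1 (lexLT_iff.2 ⟨l, h1, ha⟩)
  · obtain ⟨k, h1, rfl⟩ := key d l a h
    exact lexLE_iff_not_lexLT.1 (hx k).2 (lexLT_iff.2 ⟨l, fun i hi => (h1 i hi).symm, ha⟩)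

/-- Admissibility of words of length at most `n` depends only on the first `n` letters of the two
bounds. -/
theorem mem_admissible_of_agree {c d c' d' : Shift m} {n : ℕ} (hc : ∀ i < n, c' i = c i)
    (hd : ∀ i < n, d' i = d i) {w : List (Fin (m + 1))} (hwn : w.length ≤ n)
    (hw : w ∈ admissible c d) : w ∈ admissible c' d' := by
  have key : ∀ (e e' : Shift m), (∀ i < n, e' i = e i) → ∀ l a, word e' 0 l ++ [a] <:+: w →
      e' l = e l ∧ word e 0 l ++ [a] <:+: w := by
    intro e e' he l a h
    have hlen := h.length_le
    simp only [List.length_append, length_word, List.length_singleton] at hlen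
    refine ⟨he l (by omega), ?_⟩
    rwa [word_eq_word_iff.2 fun i hi => ?_]
    simpa using (he i (by omega)).symm
  refine fun l a => ⟨fun ha h => ?_, fun ha h => ?_⟩
  · obtain ⟨h1, h2⟩ := key c c' hc l a h
    exact (hw l a).1 (h1 ▸ ha) h2
  · obtain ⟨h1, h2⟩ := key d d' hd l a h
    exact (hw l a).2 (h1 ▸ ha) h2

theorem count_admissible_le_of_agree {c d c' d' : Shift m} {n : ℕ} (hc : ∀ i < n, c' i = c i)
    (hd : ∀ i < n, d' i = d i) : count (admissible c' d') n ≤ count (admissible c d) n := by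
  refine Nat.card_le_card_of_injective (fun f => ⟨f.1, mem_admissible_of_agree
    (fun i hi => (hc i hi).symm) (fun i hi => (hd i hi).symm) (by simp) f.2⟩) fun f g h => ?_
  exact Subtype.ext (congrArg (fun z => z.1) h)

/-- A pending match of `c` or `d` in `p` is contained in its longest suffix `u` among the prefixes
of `c` and `d`, so a forbidden factor of `p ++ w` lies in `p` or in `u ++ w`. -/
theorem append_mem_admissible {c d : Shift m} {p u w : List (Fin (m + 1))}
    (hu : IsLongestSuffix (prefixes c d) p u) (hp : p ∈ admissible c d)
    (huw : u ++ w ∈ admissible c d) : p ++ w ∈ admissible c d := by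
  have key : ∀ v ∈ prefixes c d, ∀ a, v ++ [a] <:+: p ++ w →
      v ++ [a] <:+: p ∨ v ++ [a] <:+: u ++ w := by
    intro v hv a h
    rcases List.infix_append_iff.1 h with h | h | ⟨s, t, hst, hs, ht⟩
    · exact Or.inl h
    · exact Or.inr (h.trans (List.suffix_append u w).isInfix)
    · rcases List.eq_nil_or_concat t with rfl | ⟨t', a', rfl⟩
      · left
        rw [hst, List.append_nil]
        exact hs.isInfix
      · right
        rw [List.concat_eq_append] at hst ht
        rw [← List.append_assoc] at hst
        have hv' : v = s ++ t' := (List.append_inj' hst rfl).1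
        obtain ⟨q, hq⟩ := hu.2.2 s (prefixes_prefix_closed c d _ _
          (hv' ▸ List.prefix_append s t') hv) hs
        obtain ⟨q', hq'⟩ := ht
        refine ⟨q, q', ?_⟩
        rw [hst, ← hq, ← hq']
        simp only [List.append_assoc]
  refine fun l a => ⟨fun ha h => ?_, fun ha h => ?_⟩
  · exact (key _ (Or.inl ⟨l, rfl⟩) a h).elim ((hp l a).1 ha) ((huw l a).1 ha)
  · exact (key _ (Or.inr ⟨l, rfl⟩) a h).elim ((hp l a).2 ha) ((huw l a).2 ha)

/-! ### The upper bound for the dimension -/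

theorem lexLE_and_lexLE_of_mem_setMM {c d x : Shift m} (hx : x ∈ setMM c d) (t : ℕ) :
    LexLE c (shift^[t] x) ∧ LexLE (shift^[t] x) d := by
  rcases Nat.eq_zero_or_pos t with rfl | ht
  · obtain ⟨h1, h2, h3⟩ := hx 1 le_rfl
    exact ⟨le_trans (α := Lex (Shift m)) h1 h2.lexLE, h3⟩
  · obtain ⟨h1, h2, h3⟩ := hx t ht
    exact ⟨h1, le_trans (α := Lex (Shift m)) h2.lexLE h3⟩

/-- The dimension is bounded by the growth rate of the admissible words of any single length `n`:
points are covered by the cylinders over concatenations of admissible words of length `n`. -/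
theorem hdim_setMM_le (hb : 1 < b) {c d : Shift m} {n : ℕ} (hn : 0 < n) {s : ℝ≥0}
    (h : (count (admissible c d) n : ℝ) ≤ b ^ ((s : ℝ) * n)) : hdim b hb (setMM c d) ≤ s := by
  classical
  have hb0 : 0 < b := by linarith
  have hcover : ∀ q : ℕ, setMM c d ⊆
      ⋃ g : Fin q → {f : Fin n → Fin (m + 1) // List.ofFn f ∈ admissible c d},
        {x : Shift m | ∀ (j : Fin q) (i : Fin n), x (j * n + i) = (g j).1 i} := fun q x hx =>
    Set.mem_iUnion.2 ⟨fun j => ⟨fun i => x (j * n + i),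
      word_mem_admissible (lexLE_and_lexLE_of_mem_setMM hx) _ n⟩, fun _ _ => rfl⟩
  refine @dimH_le_of_covers (Shift m) (seqMetric m b hb) (setMM c d) s (m / (b - 1)) ((b⁻¹) ^ n)
    (div_nonneg (Nat.cast_nonneg _) (by linarith)) (by positivity)
    (pow_lt_one₀ (by positivity) (inv_lt_one_of_one_lt₀ hb) hn.ne') (count (admissible c d) n) ?_
    (fun q => Fin q → {f : Fin n → Fin (m + 1) // List.ofFn f ∈ admissible c d}) _ (fun q => ?_)
    (fun q g => {x | ∀ (j : Fin q) (i : Fin n), x (j * n + i) = (g j).1 i}) ?_ hcover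
  · have h1 : ((b⁻¹) ^ n) ^ (s : ℝ) = (b ^ ((s : ℝ) * n))⁻¹ := by
      rw [inv_pow, Real.inv_rpow (by positivity), ← Real.rpow_natCast, ← Real.rpow_mul hb0.le,
        mul_comm]
    rw [h1, ← div_eq_mul_inv]
    exact div_le_one_of_le₀ h (by positivity)
  · rw [Fintype.card_fun, Fintype.card_fin, count, Nat.card_eq_fintype_card]
  · intro q g x hx y hy
    rw [← pow_mul, mul_comm n q]
    refine seqDist_le_of_agree hb fun i hi => ?_
    have h1 := hx ⟨i / n, Nat.div_lt_of_lt_mul (by rwa [mul_comm])⟩ ⟨i % n, Nat.mod_lt _ hn⟩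
    have h2 := hy ⟨i / n, Nat.div_lt_of_lt_mul (by rwa [mul_comm])⟩ ⟨i % n, Nat.mod_lt _ hn⟩
    simp only [Nat.div_add_mod'] at h1 h2
    rw [h1, h2]

/-! ### Concatenations of blocks -/

/-- The concatenation of a sequence of blocks of length `n`. -/
def concat {n : ℕ} (hn : 0 < n) (ω : ℕ → Fin n → Fin (m + 1)) : Shift m :=
  fun i => ω (i / n) ⟨i % n, Nat.mod_lt _ hn⟩

theorem concat_apply {n : ℕ} (hn : 0 < n) (ω : ℕ → Fin n → Fin (m + 1)) (j : ℕ) (i : Fin n) :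
    concat hn ω (j * n + i) = ω j i := by
  have h1 : (j * n + i) / n = j := by
    rw [mul_comm, Nat.mul_add_div hn, Nat.div_eq_of_lt i.2, add_zero]
  have h2 : (j * n + i) % n = i := by rw [mul_comm, Nat.mul_add_mod, Nat.mod_eq_of_lt i.2]
  simp only [concat, h1, h2]

theorem concat_mul_add {n : ℕ} (hn : 0 < n) (ω : ℕ → Fin n → Fin (m + 1)) (q i : ℕ) :
    concat hn ω (q * n + i) = concat hn (fun j => ω (q + j)) i := by
  have h1 : (q * n + i) / n = q + i / n := by rw [mul_comm, Nat.mul_add_div hn]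
  have h2 : (q * n + i) % n = i % n := by rw [mul_comm, Nat.mul_add_mod]
  simp only [concat, h1, h2]

theorem word_concat {n : ℕ} (hn : 0 < n) (ω : ℕ → Fin n → Fin (m + 1)) (q : ℕ) :
    word (concat hn ω) (q * n) n = List.ofFn (ω q) := by
  simp only [word, concat_apply]

/-- Let all concatenations of blocks from `B` have their orbits between `c` and `d`, and let `v` be
the largest window of length `2 * n` in them. A concatenation `concat hn ω'` of blocks that are not
factors of `v` is a shift of a point of `setMM c d`: placed behind an initial piece that
contains `v`, it only contributes shifts that are smaller than an earlier one, so the shifts have a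
last maximum, and that shift belongs to `setMM c d`. -/
theorem concat_mem_iUnion_iterate {c d : Shift m} {n : ℕ} (hn : 0 < n)
    {B : Set (Fin n → Fin (m + 1))}
    (hB : ∀ ω : ℕ → Fin n → Fin (m + 1), (∀ j, ω j ∈ B) →
      ∀ t, LexLE c (shift^[t] (concat hn ω)) ∧ LexLE (shift^[t] (concat hn ω)) d)
    {v : Fin (2 * n) → Fin (m + 1)} {ω₀ : ℕ → Fin n → Fin (m + 1)} (hω₀ : ∀ j, ω₀ j ∈ B) {t₀ : ℕ}
    (hv : ∀ i : Fin (2 * n), v i = concat hn ω₀ (t₀ + i))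
    (hmax : ∀ ω : ℕ → Fin n → Fin (m + 1), (∀ j, ω j ∈ B) → ∀ t,
      toLex (fun i : Fin (2 * n) => concat hn ω (t + i)) ≤ toLex v)
    {ω' : ℕ → Fin n → Fin (m + 1)} (hω' : ∀ j, ω' j ∈ B)
    (havoid : ∀ j, ∀ i : Fin n, ω' j ≠ fun k : Fin n => v ⟨i + k, by omega⟩) :
    concat hn ω' ∈ ⋃ k : ℕ, shift^[k] '' setMM c d := by
  set J := t₀ + 2 with hJ
  have hJn : t₀ + 2 * n ≤ J * n := by nlinarith
  set ω : ℕ → Fin n → Fin (m + 1) := fun j => if j < J then ω₀ j else ω' (j - J) with hω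
  set X := concat hn ω with hX
  have hωB : ∀ j, ω j ∈ B := fun j => by
    rw [hω]; dsimp only; split_ifs
    · exact hω₀ j
    · exact hω' _
  have hhead : ∀ i < J * n, X i = concat hn ω₀ i := fun i hi => by
    have h1 : i / n < J := Nat.div_lt_of_lt_mul (by rwa [mul_comm])
    simp only [hX, concat, hω, h1, if_true]
  have htail : ∀ i, X (J * n + i) = concat hn ω' i := fun i => by
    rw [hX, concat_mul_add]
    simp only [hω, concat, Nat.not_lt.2 (Nat.le_add_right J _), if_false, Nat.add_sub_cancel_left]
  have hstrict : ∀ k, LexLT (shift^[J * n + k] X) (shift^[t₀] X) := by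
    intro k
    have hne : (fun i : Fin (2 * n) => concat hn ω' (k + i)) ≠ v := by
      intro he
      -- the block of `ω'` that starts at the first multiple of `n` not below `k` lies inside
      -- the window
      obtain ⟨q, i, hi, hqi⟩ : ∃ q i, i < n ∧ q * n = k + i := by
        refine ⟨(k + (n - 1)) / n, (k + (n - 1)) / n * n - k, ?_, ?_⟩ <;>
        · have h1 := Nat.div_add_mod' (k + (n - 1)) n
          have h2 := Nat.mod_lt (k + (n - 1)) hn
          omega
      refine havoid q ⟨i, hi⟩ (funext fun l => ?_)
      rw [← he]
      dsimp only
      rw [← concat_apply hn ω' q l, hqi, add_assoc]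
    obtain ⟨l, hl1, hl2⟩ := lt_of_le_of_ne (hmax ω' hω' k) hne
    have hread : ∀ i : Fin (2 * n), shift^[t₀] X i = v i := fun i => by
      rw [iterate_shift_apply, hv, hhead _ (by have := i.2; omega)]
    have hread' : ∀ i : Fin (2 * n), shift^[J * n + k] X i = concat hn ω' (k + i) := fun i => by
      rw [iterate_shift_apply, add_assoc, htail]
    refine lexLT_iff.2 ⟨l, fun i hi => ?_, ?_⟩
    · have h1 := hl1 ⟨i, hi.trans l.2⟩ hi
      have h2 := hread ⟨i, hi.trans l.2⟩
      have h3 := hread' ⟨i, hi.trans l.2⟩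
      rw [h2, h3]
      exact h1
    · rw [hread, hread']
      exact hl2
  have hne : (Finset.Ico t₀ (J * n)).Nonempty := Finset.nonempty_Ico.2 (by omega)
  -- comparing the pairs `(σʲ X, j)` selects the last among the positions of the maximal shift
  obtain ⟨j₀, hj₀, hj₀max⟩ := Finset.exists_max_image (Finset.Ico t₀ (J * n))
    (fun j => (toLex (toLex (shift^[j] X), j) : Lex (Shift m) ×ₗ ℕ)) hne
  rw [Finset.mem_Ico] at hj₀
  have hj₀ge : ∀ j ∈ Finset.Ico t₀ (J * n), LexLE (shift^[j] X) (shift^[j₀] X) := fun j hj => by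
    rcases Prod.Lex.toLex_le_toLex.1 (hj₀max j hj) with h | h
    · exact le_of_lt h
    · exact le_of_eq h.1
  refine Set.mem_iUnion.2 ⟨J * n - j₀, shift^[j₀] X, fun k hk => ?_, ?_⟩
  · rw [← Function.iterate_add_apply]
    refine ⟨(hB ω hωB _).1, ?_, (hB ω hωB _).2⟩
    by_cases hlt : k + j₀ < J * n
    · rcases Prod.Lex.toLex_le_toLex.1 (hj₀max (k + j₀)
        (Finset.mem_Ico.2 ⟨by omega, hlt⟩)) with h | h
      · exact h
      · have := h.2
        dsimp only at this
        omega
    · have h1 := hstrict (k + j₀ - J * n)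
      rw [show J * n + (k + j₀ - J * n) = k + j₀ by omega] at h1
      exact lt_of_lt_of_le (α := Lex (Shift m)) h1
        (hj₀ge t₀ (Finset.mem_Ico.2 ⟨le_rfl, by omega⟩))
  · rw [← Function.iterate_add_apply, show J * n - j₀ + j₀ = J * n by omega]
    funext i
    rw [iterate_shift_apply, htail]

/-- The lower bound for the dimension, from a large set of freely concatenable blocks. At most `n`
blocks are factors of the largest window, and the concatenations of the others are shifts of
points of `setMM c d`. -/
theorem le_hdim_setMM_of_blocks (hb : 1 < b) {c d : Shift m} {n : ℕ} (hn : 0 < n)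
    {B : Finset (Fin n → Fin (m + 1))}
    (hB : ∀ ω : ℕ → Fin n → Fin (m + 1), (∀ j, ω j ∈ B) →
      ∀ t, LexLE c (shift^[t] (concat hn ω)) ∧ LexLE (shift^[t] (concat hn ω)) d)
    {s : ℝ≥0} (hs : 0 < s) (hcard : (n : ℝ) + 2 + b ^ ((s : ℝ) * n) ≤ B.card) :
    (s : ℝ≥0∞) ≤ hdim b hb (setMM c d) := by
  classical
  have hb0 : 0 < b := by linarith
  have hpos : 0 < b ^ ((s : ℝ) * n) := by positivity
  obtain ⟨β, hβ⟩ : B.Nonempty := by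
    rw [← Finset.card_pos]
    have h : (0 : ℝ) < B.card := lt_of_lt_of_le (by positivity) hcard
    exact_mod_cast h
  obtain ⟨v, ⟨ω₀, t₀, hω₀, rfl⟩, hmax⟩ := Set.exists_max_image
    {v : Fin (2 * n) → Fin (m + 1) | ∃ (ω : ℕ → Fin n → Fin (m + 1)) (t : ℕ), (∀ j, ω j ∈ B) ∧
      (fun i : Fin (2 * n) => concat hn ω (t + i)) = v} toLex (Set.toFinite _)
    ⟨_, fun _ => β, 0, fun _ => hβ, rfl⟩
  set v : Fin (2 * n) → Fin (m + 1) := fun i => concat hn ω₀ (t₀ + i)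
  set R := Finset.univ.image (fun i : Fin n => fun k : Fin n => v ⟨i + k, by omega⟩)
  set B' := B \ R
  have hcard' : b ^ ((s : ℝ) * n) + 2 ≤ B'.card := by
    have h1 : B.card ≤ B'.card + n := by
      have h2 : B.card - R.card ≤ B'.card := Finset.le_card_sdiff R B
      have h3 : R.card ≤ n := Finset.card_image_le.trans_eq (Finset.card_fin n)
      omega
    have h4 : (B.card : ℝ) ≤ B'.card + n := by exact_mod_cast h1
    linarith
  have hr : 1 < B'.card := by
    have h : (1 : ℝ) < B'.card := by linarith
    exact_mod_cast h
  set Φ : (ℕ → Fin B'.card) → Shift m := fun w => concat hn fun j => (B'.equivFin.symm (w j)).1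
    with hΦ
  have hsub : Set.range Φ ⊆ ⋃ k : ℕ, shift^[k] '' setMM c d := by
    rintro _ ⟨w, rfl⟩
    have hw : ∀ j, (B'.equivFin.symm (w j)).1 ∈ B' := fun j => (B'.equivFin.symm (w j)).2
    refine concat_mem_iUnion_iterate hn (B := B) hB hω₀ (v := v) (fun _ => rfl)
      (fun ω hω t => hmax _ ⟨ω, t, hω, rfl⟩) (fun j => (Finset.mem_sdiff.1 (hw j)).1)
      fun j i h => (Finset.mem_sdiff.1 (hw j)).2 ?_
    rw [h]
    exact Finset.mem_image_of_mem _ (Finset.mem_univ i)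
  refine le_trans ?_ (@dimH_le_of_subset_iUnion_iterate (Shift m) (seqMetric m b hb) shift b
    (seqDist_shift_le hb) (Set.range Φ) (setMM c d) hsub)
  refine @le_dimH_range_of_separated (Shift m) (seqMetric m b hb) B'.card hr ((b⁻¹) ^ n)
    (by positivity) s hs ?_ Φ fun w w' j hj => ?_
  · have h1 : ((b⁻¹) ^ n) ^ (s : ℝ) = (b ^ ((s : ℝ) * n))⁻¹ := by
      rw [inv_pow, Real.inv_rpow (by positivity), ← Real.rpow_natCast, ← Real.rpow_mul hb0.le,
        mul_comm]
    rw [h1, ← div_eq_mul_inv, one_le_div hpos]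
    linarith
  · have hne : (B'.equivFin.symm (w j)).1 ≠ (B'.equivFin.symm (w' j)).1 := fun h =>
      hj (B'.equivFin.symm.injective (Subtype.ext h))
    obtain ⟨i, hi⟩ := Function.ne_iff.1 hne
    have h1 : Φ w (j * n + i) ≠ Φ w' (j * n + i) := by
      rw [hΦ]
      simp only [concat_apply]
      exact hi
    refine le_trans ?_ (le_seqDist_of_ne hb h1)
    rw [← pow_mul]
    refine pow_le_pow_of_le_one (by positivity) (inv_le_one_of_one_le₀ hb.le) ?_
    have := i.2
    nlinarith

/-! ### Return words as freely concatenable blocks -/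

theorem concat_returns {c d : Shift m} {u : List (Fin (m + 1))} (hu : u ∈ prefixes c d) {n : ℕ}
    (hn : 0 < n) {ω : ℕ → Fin n → Fin (m + 1)}
    (hω : ∀ j, List.ofFn (ω j) ∈ returns (prefixes c d) (admissible c d) u) (q : ℕ) :
    u ++ word (concat hn ω) 0 (q * n) ∈ admissible c d ∧
      IsLongestSuffix (prefixes c d) (u ++ word (concat hn ω) 0 (q * n)) u := by
  induction q with
  | zero =>
    rw [zero_mul, word, List.ofFn_zero, List.append_nil]
    exact ⟨admissible_infix_closed c d _ _ (List.prefix_append u _).isInfix (hω 0).1,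
      hu, List.suffix_rfl, fun v _ h => h⟩
  | succ q ih =>
    rw [Nat.succ_mul, word_add, zero_add, word_concat, ← List.append_assoc]
    exact ⟨append_mem_admissible ih.2 ih.1 (hω q).1,
      (ih.2.append_iff (prefixes_prefix_closed c d) _ _).2 (hω q).2⟩

/-- A concatenation of return words of length `n` contains no prefix of `c` or `d` that is longer
than `u.length + n`: cut at the end of a suitable block, it would be a suffix longer than `u`. -/
theorem word_concat_notMem_prefixes {c d : Shift m} {u : List (Fin (m + 1))}
    (hu : u ∈ prefixes c d) {n : ℕ} (hn : 0 < n) {ω : ℕ → Fin n → Fin (m + 1)}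
    (hω : ∀ j, List.ofFn (ω j) ∈ returns (prefixes c d) (admissible c d) u) (t : ℕ) :
    word (concat hn ω) t (u.length + n + 1) ∉ prefixes c d := by
  intro hmem
  obtain ⟨q, l, hl, hln, hq⟩ : ∃ q l, u.length < l ∧ l ≤ u.length + n + 1 ∧ q * n = t + l := by
    refine ⟨(t + u.length) / n + 1, ((t + u.length) / n + 1) * n - t, ?_, ?_, ?_⟩ <;>
    · have h1 := Nat.div_add_mod' (t + u.length) n
      have h2 := Nat.mod_lt (t + u.length) hn
      rw [add_mul, one_mul]
      omega
  obtain ⟨k, hk⟩ := Nat.exists_eq_add_of_le hln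
  have h1 : word (concat hn ω) t l ∈ prefixes c d := by
    refine prefixes_prefix_closed c d _ _ ?_ hmem
    rw [hk, word_add]
    exact List.prefix_append _ _
  have h2 := (concat_returns hu hn hω q).2.2.2 _ h1 (by
    rw [hq, word_add, zero_add, ← List.append_assoc]
    exact List.suffix_append _ _)
  have h3 := h2.length_le
  rw [length_word] at h3
  omega

/-- The orbit of a concatenation of return words stays between all bounds that agree with `c` and
`d` on sufficiently many letters. -/
theorem lexLE_concat_of_agree {c d c' d' : Shift m} {u : List (Fin (m + 1))}
    (hu : u ∈ prefixes c d) {n : ℕ} (hn : 0 < n)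
    (hc : ∀ i < u.length + n + 1, c' i = c i) (hd : ∀ i < u.length + n + 1, d' i = d i)
    {ω : ℕ → Fin n → Fin (m + 1)}
    (hω : ∀ j, List.ofFn (ω j) ∈ returns (prefixes c d) (admissible c d) u) (t : ℕ) :
    LexLE c' (shift^[t] (concat hn ω)) ∧ LexLE (shift^[t] (concat hn ω)) d' := by
  classical
  set X := concat hn ω with hX
  set k := u.length + n + 1 with hk
  have hnot : word X t k ∉ prefixes c d := word_concat_notMem_prefixes hu hn hω t
  have hadm : word X t k ∈ admissible c d := by
    have h1 : t + k ≤ (t + k) * n := Nat.le_mul_of_pos_right _ hn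
    obtain ⟨r, hr⟩ := Nat.exists_eq_add_of_le h1
    refine admissible_infix_closed c d _ _ ?_ (concat_returns hu hn hω (t + k)).1
    rw [hr, word_add _ 0, word_add _ 0 t k, zero_add]
    exact ⟨u ++ word X 0 t, word X (t + k) r, by simp [hX]⟩
  have key : ∀ e : Shift m, word X t k ∉ Set.range (word e 0) →
      ∃ l < k, (∀ i < l, X (t + i) = e i) ∧ X (t + l) ≠ e l ∧
        word e 0 l ++ [X (t + l)] <:+: word X t k := by
    intro e he
    have hex : ∃ l, l < k ∧ X (t + l) ≠ e l := by
      by_contra! hcon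
      exact he ⟨k, word_eq_word_iff.2 fun i hi => by rw [zero_add, hcon i hi]⟩
    obtain ⟨hl1, hl2⟩ := Nat.find_spec hex
    have hmin : ∀ i < Nat.find hex, X (t + i) = e i := fun i hi => by
      by_contra hne
      exact Nat.find_min hex hi ⟨hi.trans hl1, hne⟩
    refine ⟨Nat.find hex, hl1, hmin, hl2, ?_⟩
    obtain ⟨r, hr⟩ := Nat.exists_eq_add_of_lt hl1
    have hw : word e 0 (Nat.find hex) = word X t (Nat.find hex) :=
      word_eq_word_iff.2 fun i hi => by rw [zero_add, hmin i hi]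
    rw [hw, ← word_succ]
    conv_rhs => rw [hr, add_right_comm, word_add]
    exact (List.prefix_append _ _).isInfix
  constructor
  · obtain ⟨l, hlk, h1, h2, h3⟩ := key c fun h => hnot (Or.inl h)
    have h4 : c l < X (t + l) := lt_of_le_of_ne
      (not_lt.1 fun h => (hadm l _).1 h h3) h2.symm
    refine LexLT.lexLE (lexLT_iff.2 ⟨l, fun i hi => ?_, ?_⟩)
    · rw [iterate_shift_apply, h1 i hi, hc i (hi.trans hlk)]
    · rw [iterate_shift_apply, hc l hlk]
      exact h4
  · obtain ⟨l, hlk, h1, h2, h3⟩ := key d fun h => hnot (Or.inr h)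
    have h4 : X (t + l) < d l := lt_of_le_of_ne
      (not_lt.1 fun h => (hadm l _).2 h h3) h2
    refine LexLT.lexLE (lexLT_iff.2 ⟨l, fun i hi => ?_, ?_⟩)
    · rw [iterate_shift_apply, h1 i hi, hd i (hi.trans hlk)]
    · rw [iterate_shift_apply, hd l hlk]
      exact h4

/-! ### The lower bound for the dimension, and continuity -/

theorem wt_prefixes_ne_top (c d : Shift m) {θ : ℝ≥0∞} (hθ : θ < 1) :
    wt θ (prefixes c d) ≠ ⊤ := by
  have key : ∀ e : Shift m, wt θ (Set.range (word e 0) : Set (List (Fin (m + 1)))) ≠ ⊤ := by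
    intro e
    refine ne_top_of_le_ne_top ?_ (wt_range_le (word e 0))
    simp only [length_word]
    rw [ENNReal.tsum_geometric]
    exact ENNReal.inv_ne_top.2 (tsub_pos_of_lt hθ).ne'
  exact ne_top_of_le_ne_top (ENNReal.add_ne_top.2 ⟨key c, key d⟩) (wt_add_le _ _)

/-- If the number of admissible words of length `n` is at least `b ^ (s * n)` for all `n`, then some
prefix of `c` or `d` has more than `b ^ (s' * n)` return words of some length `n > 0`. The surplus
`n + 2` leaves room for discarding `n` of them and keeping at least two. -/
theorem exists_count_returns_ge (hb : 1 < b) {c d : Shift m} {s s' : ℝ} (hs' : 0 < s')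
    (hss : s' < s) (h : ∀ n : ℕ, b ^ (s * n) ≤ count (admissible c d) n) :
    ∃ u ∈ prefixes c d, ∃ n : ℕ, 0 < n ∧
      (n : ℝ) + 2 + b ^ (s' * n) ≤ count (returns (prefixes c d) (admissible c d) u) n := by
  have hb0 : 0 < b := by linarith
  set τ : ℝ := b ^ (-s) with hτ
  have hτ0 : 0 < τ := Real.rpow_pos_of_pos hb0 _
  have hτ1 : τ < 1 := Real.rpow_lt_one_of_one_lt_of_neg hb (by linarith)
  have hpow : ∀ (r : ℝ) (n : ℕ), b ^ (r * n) = (b ^ r) ^ n := fun r n => by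
    rw [Real.rpow_mul hb0.le, Real.rpow_natCast]
  have hθ1 : ENNReal.ofReal τ < 1 := by
    rwa [← ENNReal.ofReal_one, ENNReal.ofReal_lt_ofReal_iff one_pos]
  have hadm : wt (ENNReal.ofReal τ) (admissible c d) = ⊤ := by
    rw [wt_eq_tsum_count, ← top_le_iff, ← ENNReal.tsum_const_eq_top_of_ne_zero (α := ℕ) one_ne_zero]
    refine ENNReal.tsum_le_tsum fun n => ?_
    rw [← ENNReal.ofReal_pow hτ0.le, ← ENNReal.ofReal_natCast, ← ENNReal.ofReal_mul (by positivity),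
      ← ENNReal.ofReal_one]
    apply ENNReal.ofReal_le_ofReal
    calc (1 : ℝ) = b ^ (s * n) * τ ^ n := by
          rw [hpow, hτ, ← mul_pow, ← Real.rpow_add hb0]; simp
      _ ≤ _ := by gcongr; exact h n
  obtain ⟨u, hu, hret⟩ := exists_wt_returns_eq_top (nil_mem_prefixes c d)
    (prefixes_prefix_closed c d) (admissible_infix_closed c d) (ENNReal.ofReal_pos.2 hτ0).ne'
    ENNReal.ofReal_ne_top (wt_prefixes_ne_top c d hθ1) hadm
  refine ⟨u, hu, ?_⟩
  by_contra! hcon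
  have hle : ∀ n : ℕ, (count (returns (prefixes c d) (admissible c d) u) n : ℝ) ≤
      n + 2 + b ^ (s' * n) := by
    intro n
    rcases Nat.eq_zero_or_pos n with rfl | hn
    · have h1 : count (returns (prefixes c d) (admissible c d) u) 0 ≤ 1 :=
        Finite.card_le_one_iff_subsingleton.2 inferInstance
      have h2 : (count (returns (prefixes c d) (admissible c d) u) 0 : ℝ) ≤ 1 := by
        exact_mod_cast h1
      have h3 : (0 : ℝ) ≤ b ^ (s' * (0 : ℕ)) := by positivity
      push_cast at h3 ⊢
      linarith
    · exact (hcon n hn).le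
  have hsum : Summable fun n : ℕ => ((n : ℝ) + 2 + b ^ (s' * n)) * τ ^ n := by
    have h1 : Summable fun n : ℕ => (n : ℝ) * τ ^ n := by
      simpa using summable_pow_mul_geometric_of_norm_lt_one 1
        (show ‖τ‖ < 1 by rwa [Real.norm_of_nonneg hτ0.le])
    have h2 : Summable fun n : ℕ => 2 * τ ^ n :=
      (summable_geometric_of_lt_one hτ0.le hτ1).mul_left 2
    have h3 : Summable fun n : ℕ => (b ^ (s' - s)) ^ n :=
      summable_geometric_of_lt_one (by positivity)
        (Real.rpow_lt_one_of_one_lt_of_neg hb (by linarith))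
    refine ((h1.add h2).add h3).congr fun n => ?_
    rw [hpow, sub_eq_add_neg, Real.rpow_add hb0, ← hτ, mul_pow]
    ring
  refine hsum.tsum_ofReal_ne_top (top_le_iff.1 (hret ▸ ?_))
  rw [wt_eq_tsum_count]
  refine ENNReal.tsum_le_tsum fun n => ?_
  rw [← ENNReal.ofReal_pow hτ0.le, ← ENNReal.ofReal_natCast,
    ← ENNReal.ofReal_mul (by positivity)]
  apply ENNReal.ofReal_le_ofReal
  gcongr
  exact hle n

/-- The lower bound for the dimension holds in a whole neighbourhood of `(c, d)`, because the blocks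
that realize it only meet finitely many letters of `c` and `d`. -/
theorem exists_forall_agree_le_hdim (hb : 1 < b) {c d : Shift m} {s s' : ℝ≥0} (hs' : 0 < s')
    (hss : s' < s) (h : ∀ n : ℕ, b ^ ((s : ℝ) * n) ≤ count (admissible c d) n) :
    ∃ k, ∀ c' d' : Shift m, (∀ i < k, c' i = c i) → (∀ i < k, d' i = d i) →
      (s' : ℝ≥0∞) ≤ hdim b hb (setMM c' d') := by
  classical
  obtain ⟨u, hu, n, hn, hcount⟩ := exists_count_returns_ge hb (c := c) (d := d)
    (NNReal.coe_pos.2 hs') (NNReal.coe_lt_coe.2 hss) h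
  refine ⟨u.length + n + 1, fun c' d' hc hd => ?_⟩
  refine le_hdim_setMM_of_blocks hb hn (B := Finset.univ.filter fun f : Fin n → Fin (m + 1) =>
    List.ofFn f ∈ returns (prefixes c d) (admissible c d) u) (fun ω hω t => ?_) hs' ?_
  · exact lexLE_concat_of_agree hu hn hc hd (fun j => (Finset.mem_filter.1 (hω j)).2) t
  · rwa [count, Nat.card_eq_fintype_card, Fintype.card_subtype] at hcount

theorem eventually_agree (p : Shift m × Shift m) (k : ℕ) :
    ∀ᶠ q in 𝓝 p, (∀ i < k, q.1 i = p.1 i) ∧ ∀ i < k, q.2 i = p.2 i := by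
  have key : ∀ c : Shift m, ∀ᶠ e in 𝓝 c, ∀ i < k, e i = c i := by
    intro c
    refine (Set.finite_lt_nat k).eventually_all.2 fun i _ => ?_
    exact (continuous_apply i).continuousAt.eventually_mem
      ((isOpen_discrete {c i}).mem_nhds (Set.mem_singleton (c i)))
  exact (continuous_fst.continuousAt.eventually (key p.1)).and
    (continuous_snd.continuousAt.eventually (key p.2))

theorem one_le_count_admissible_zero (c d : Shift m) : 1 ≤ count (admissible c d) 0 := by
  refine Finite.card_pos_iff.2 ⟨⟨Fin.elim0, fun l a => ⟨fun _ h => ?_, fun _ h => ?_⟩⟩⟩ <;>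
  simp at h

/-- The upper bound `hdim_setMM_le` at nearby bounds and the lower bound
`exists_forall_agree_le_hdim` involve the same numbers of admissible words, so together they give
both semicontinuities. -/
theorem continuous_hdim_setMM (hb : 1 < b) :
    Continuous fun p : Shift m × Shift m => hdim b hb (setMM p.1 p.2) := by
  refine continuous_iff_continuousAt.2 fun p => tendsto_order.2 ⟨fun a ha => ?_, fun a ha => ?_⟩
  · obtain ⟨s₁, ha1, h1⟩ := ENNReal.lt_iff_exists_nnreal_btwn.1 ha
    obtain ⟨s₂, h12, h2⟩ := ENNReal.lt_iff_exists_nnreal_btwn.1 h1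
    have hs1 : 0 < s₁ := ENNReal.coe_pos.1 (bot_le.trans_lt ha1)
    obtain ⟨k, hk⟩ := exists_forall_agree_le_hdim hb (c := p.1) (d := p.2) hs1
      (ENNReal.coe_lt_coe.1 h12) fun n => by
        rcases Nat.eq_zero_or_pos n with rfl | hn
        · simpa using one_le_count_admissible_zero p.1 p.2
        · by_contra! hcon
          exact absurd (hdim_setMM_le hb hn hcon.le) (not_le.2 h2)
    filter_upwards [eventually_agree p k] with q hq
    exact ha1.trans_le (hk q.1 q.2 hq.1 hq.2)
  · obtain ⟨s₁, h1, h1a⟩ := ENNReal.lt_iff_exists_nnreal_btwn.1 ha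
    obtain ⟨s₂, h12, h2a⟩ := ENNReal.lt_iff_exists_nnreal_btwn.1 h1a
    have hs1 : 0 < s₁ := ENNReal.coe_pos.1 (bot_le.trans_lt h1)
    obtain ⟨n, hn⟩ : ∃ n : ℕ, (count (admissible p.1 p.2) n : ℝ) < b ^ ((s₂ : ℝ) * n) := by
      by_contra! hcon
      obtain ⟨k, hk⟩ := exists_forall_agree_le_hdim hb hs1 (ENNReal.coe_lt_coe.1 h12) hcon
      exact absurd (hk p.1 p.2 (fun _ _ => rfl) fun _ _ => rfl) (not_le.2 h1)
    have hn0 : 0 < n := by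
      rcases Nat.eq_zero_or_pos n with rfl | h
      · have h0 := one_le_count_admissible_zero p.1 p.2
        have h1 : count (admissible p.1 p.2) 0 < 1 := by simpa using hn
        omega
      · exact h
    filter_upwards [eventually_agree p n] with q hq
    refine lt_of_le_of_lt (hdim_setMM_le hb hn0 (le_trans ?_ hn.le)) h2a
    exact_mod_cast count_admissible_le_of_agree hq.1 hq.2

theorem lexLE_of_forall_le {x y : Shift m} (h : ∀ i, x i ≤ y i) : LexLE x y :=
  lexLE_iff_not_lexLT.2 fun ⟨l, _, hl⟩ => absurd (h l) (not_le.2 hl)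

theorem setM_eq_setMM (c : Shift m) : setM c = setMM (fun _ => 0) c :=
  Set.ext fun _ => forall₂_congr fun _ _ =>
    ⟨fun h => ⟨lexLE_of_forall_le fun _ => Fin.zero_le _, h⟩, fun h => h.2⟩

theorem setN_eq_setMM (c : Shift m) : setN c = setMM c (fun _ => Fin.last m) :=
  Set.ext fun _ => forall₂_congr fun _ _ =>
    ⟨fun h => ⟨h.1, h.2, lexLE_of_forall_le fun _ => Fin.le_last _⟩, fun h => ⟨h.1, h.2.1⟩⟩

end KneadingShift

theorem mainTheorem8 (m : ℕ) (b : ℝ) (hb : 1 < b) :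
    (Continuous fun p : KneadingShift.Shift m × KneadingShift.Shift m =>
      KneadingShift.hdim b hb (KneadingShift.setMM p.1 p.2)) ∧
    (Continuous fun c : KneadingShift.Shift m =>
      KneadingShift.hdim b hb (KneadingShift.setM c)) ∧
    (Continuous fun c : KneadingShift.Shift m =>
      KneadingShift.hdim b hb (KneadingShift.setN c)) := by
  have h := KneadingShift.continuous_hdim_setMM (m := m) hb
  refine ⟨h, ?_, ?_⟩
  · simp only [KneadingShift.setM_eq_setMM]
    exact h.comp (continuous_const.prodMk continuous_id)
  · simp only [KneadingShift.setN_eq_setMM]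
    exact h.comp (continuous_id.prodMk continuous_const)
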